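/- For an integer $r\ge 1$, an $r$-graph $G$ is a pair $(V(G),E(G))$ in which $V(G)$ is a finite set and $E(G)\subseteq V(G)^{(r)}$, where $V(G)^{(r)}$ is the set of $r$-element subsets of $V(G)$. Its order is $|V(G)|$ and its density is $|E(G)|/|V(G)^{(r)}|$. A subgraph of $G$ is an $r$-graph $H$ with $V(H)\subseteq V(G)$ and $E(H)\subseteq E(G)$. A number $\alpha\in[0,1)$ is a jump for $r$-graphs if there is $\delta>0$ such that for every $\varepsilon>0$ and every integer $n\ge r$ there is an $N$ such that every $r$-graph of order at least $N$ and density at least $\alpha+\varepsilon$ has a subgraph of order $n$ and density at least $\alpha+\delta$. A number $\alpha\in[0,1)$ that is not a jump for $r$-graphs is called a non-jump for $r$-graphs. **Theorem.** The number $$\alpha_3^*=\frac{6}{121}\left(5\sqrt5-2\right)=0.4552\dots$$ is a non-jump for $3$-graphs. -/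

import Mathlib

/-- An `r`-graph (a finite `r`-uniform hypergraph) with vertices taken from the type `V`:
a finite vertex set together with a set of `r`-element subsets of it. -/
structure RGraph (r : ℕ) (V : Type) where
  verts : Finset V
  edges : Finset (Finset V)
  edges_subset : edges ⊆ verts.powersetCard r

namespace RGraph

variable {r : ℕ} {V : Type}

/-- The order of an `r`-graph: its number of vertices. -/
def order (G : RGraph r V) : ℕ := G.verts.card

/-- The density `|E(G)| / |V(G)^{(r)}|`: the proportion of the `r`-subsets of the vertex set
that are edges. -/
noncomputable def density (G : RGraph r V) : ℝ :=
  (G.edges.card : ℝ) / ((G.verts.powersetCard r).card : ℝ)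

/-- `H` is a (not necessarily induced) subgraph of `G`. -/
def IsSubgraph (H G : RGraph r V) : Prop :=
  H.verts ⊆ G.verts ∧ H.edges ⊆ G.edges

end RGraph

/-- The defining property of a jump `α` for `r`-graphs: there is `δ > 0` such that for each
`ε > 0` and `n ≥ r`, any sufficiently large `r`-graph of density at least `α + ε` has a subgraph
of order `n` and density at least `α + δ`. -/
def HasJump (r : ℕ) (α : ℝ) : Prop :=
  ∃ δ : ℝ, 0 < δ ∧ ∀ ε : ℝ, 0 < ε → ∀ n : ℕ, r ≤ n →
    ∃ N : ℕ, ∀ (V : Type) (G : RGraph r V), N ≤ G.order → α + ε ≤ G.density →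
      ∃ H : RGraph r V, H.IsSubgraph G ∧ H.order = n ∧ α + δ ≤ H.density

/-- `α` is a non-jump for `r`-graphs: a number in `[0, 1)` which is not a jump. -/
def IsNonJump (r : ℕ) (α : ℝ) : Prop :=
  α ∈ Set.Ico (0 : ℝ) 1 ∧ ¬ HasJump r α

/-!
The proof follows the method of Frankl and Rödl. If `α = 6 / 121 * (5 * √5 - 2)` were a jump, then
for large `n` every large enough `3`-graph of density above `α` by a fixed margin `ε > 0` would have
a subgraph on `n` vertices whose density exceeds `α` by `δ`. For each `n` there are, however,
arbitrarily large `3`-graphs of density at least `α + ε` (with `ε` depending only on `n`) all of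
whose `n`-vertex subgraphs have at most `α n³ / 6` edges (`exists_dense_locally_bounded`).

The vertices lie in four parts `A, B, C, Y`, with weights in the ratio `1 : 1 : 1 + √5 : √5`. The
edges consist of a vertex of `Y` with a pair outside `Y` that is not an `A`-`B` pair, or of one vertex
from each of `A`, `B`, `C`. The polynomial of this pattern is
`3 y (s² - 2 a b) + 6 a b c = 3 y s² + 6 a b (c - y)` with `s = a + b + c`, and by AM-GM it is at most
`3 y s² + (2/9) (s - y)³` for `y ≤ c`. The latter has maximum `α` on `s + y = 1`, attained at
`y = (10 - 3 √5) / 11` (`alphaStar_sub_eq`). The part `A` is moreover divided into `t` fibres; pairs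
inside one fibre are not joined to `Y`, and the triples of fibres in a `3`-graph `F` on `t` points
are added. Here `F` has at least `14 t²` edges, so that for the whole graph the added triples
outweigh the omitted pairs (`density_increment`), but every `k` points with `2 ≤ k ≤ n` span at
most `k - 2` edges of `F`. Such an `F` is found by the deletion method (`exists_locallySparse`).

In a subgraph on `n` vertices, let `w` be the sizes of the fibres. By Hall's theorem the edges of `F`
have distinct representatives outside the two heaviest fibres, of sizes `p` and `q`, so the added
triples number at most `p q (a - p - q)`, while at least `y (p² + q²) / 2` are lost on the pairs inside
the fibres. By AM-GM again the net gain, counted in ordered triples, is at most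
`(2/9) max (0, a - y)³` (`LocallySparse.gain_sub_loss_le`). So either correction to `3 y s²`, the gain
just described or `6 a b (c - y)`, leads to the same bound `3 y s² + (2/9) (s - y)³`, and when both
are present the sum is still at most `α` (`lagrangian_le`).
-/

open Finset

/-! ### Locally sparse `3`-graphs -/

/-- A family of finite sets is `n`-locally sparse if every nonempty subfamily covering at most `n`
points covers at least two points more than it has members. -/
def LocallySparse {α : Type*} [DecidableEq α] (n : ℕ) (F : Finset (Finset α)) : Prop :=
  ∀ J ⊆ F, J.Nonempty → (J.biUnion id).card ≤ n → J.card + 2 ≤ (J.biUnion id).card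

theorem card_functions_vanishing {β : Type*} [Fintype β] [DecidableEq β] (q : ℕ) (J : Finset β) :
    ((univ.filter fun ω : β → Fin (q + 1) => ∀ e ∈ J, ω e = 0).card : ℝ)
      = ((q + 1 : ℕ) : ℝ) ^ Fintype.card β * (((q + 1 : ℕ) : ℝ)⁻¹) ^ J.card := by
  have h : (univ.filter fun ω : β → Fin (q + 1) => ∀ e ∈ J, ω e = 0)
      = Fintype.piFinset fun e => if e ∈ J then {0} else univ := by
    ext ω
    simp only [mem_filter, mem_univ, true_and, Fintype.mem_piFinset]
    refine forall_congr' fun e => ?_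
    by_cases he : e ∈ J <;> simp [he]
  have h2 : ∀ e : β, (if e ∈ J then ({0} : Finset (Fin (q + 1))) else univ).card
      = if e ∈ J then 1 else q + 1 := by
    intro e; split_ifs <;> simp
  rw [h, Fintype.card_piFinset]
  simp only [h2]
  rw [Finset.prod_ite]
  have h3 : (univ.filter fun e => e ∉ J).card + J.card = Fintype.card β := by
    have : (univ.filter fun e => e ∉ J) = Jᶜ := by ext; simp
    rw [this]; exact Finset.card_compl_add_card J
  rw [← h3, pow_add]
  have h4 : ((q + 1 : ℕ) : ℝ) ≠ 0 := by positivity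
  simp only [prod_const, one_pow, one_mul, Nat.cast_pow]
  rw [mul_assoc, ← mul_pow, mul_inv_cancel₀ h4, one_pow, mul_one]

/-- The deletion method: keep each element of `T` with probability `1 / (q + 1)` and then remove one
element from every surviving forbidden set. -/
theorem exists_subset_avoiding {β ι : Type*} [Fintype β] [DecidableEq β] [DecidableEq ι] (q : ℕ)
    (T : Finset β) (I : Finset ι) (J : ι → Finset β) (hJ : ∀ i ∈ I, (J i).Nonempty) :
    ∃ F ⊆ T, (∀ i ∈ I, ¬ J i ⊆ F) ∧
      (T.card : ℝ) * ((q + 1 : ℕ) : ℝ)⁻¹ - ∑ i ∈ I, (((q + 1 : ℕ) : ℝ)⁻¹) ^ (J i).card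
        ≤ F.card := by
  classical
  set Q : ℝ := ((q + 1 : ℕ) : ℝ) with hQ
  -- a choice of `ω` for which the number of kept elements minus the number of surviving
  -- forbidden sets is at least its average
  obtain ⟨ω, -, hω⟩ : ∃ ω ∈ (univ : Finset (β → Fin (q + 1))),
      (T.card : ℝ) * Q⁻¹ - ∑ i ∈ I, Q⁻¹ ^ (J i).card
        ≤ ((T.filter fun e => ω e = 0).card : ℝ)
          - ((I.filter fun i => ∀ e ∈ J i, ω e = 0).card : ℝ) := by
    apply Finset.exists_le_of_sum_le univ_nonempty
    simp only [Finset.sum_sub_distrib]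
    have h1 : ∑ ω : β → Fin (q + 1), ((T.filter fun e => ω e = 0).card : ℝ)
        = ∑ e ∈ T, Q ^ Fintype.card β * Q⁻¹ := by
      simp only [Finset.card_filter, Nat.cast_sum]
      rw [Finset.sum_comm]
      refine Finset.sum_congr rfl fun e _ => ?_
      have := card_functions_vanishing q ({e} : Finset β)
      simp only [mem_singleton, forall_eq, card_singleton, pow_one] at this
      rw [← this, Finset.card_filter, Nat.cast_sum]
    have h2 : ∑ ω : β → Fin (q + 1), ((I.filter fun i => ∀ e ∈ J i, ω e = 0).card : ℝ)
        = ∑ i ∈ I, Q ^ Fintype.card β * Q⁻¹ ^ (J i).card := by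
      simp only [Finset.card_filter, Nat.cast_sum]
      rw [Finset.sum_comm]
      refine Finset.sum_congr rfl fun i _ => ?_
      rw [← card_functions_vanishing q (J i), Finset.card_filter, Nat.cast_sum]
    rw [h1, h2]
    simp only [← Finset.mul_sum, sum_const, nsmul_eq_mul, card_univ, Fintype.card_fun, Fintype.card_fin]
    push_cast
    apply le_of_eq
    rw [hQ]; push_cast; ring
  rcases I.eq_empty_or_nonempty with rfl | ⟨i₀, hi₀⟩
  · refine ⟨T.filter fun e => ω e = 0, filter_subset _ _, by simp, ?_⟩
    simpa using hω
  have : Nonempty β := (hJ i₀ hi₀).to_type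
  choose! f hf using hJ
  set F₀ := T.filter fun e => ω e = 0
  set D := (I.filter fun i => ∀ e ∈ J i, ω e = 0).image f
  refine ⟨F₀ \ D, sdiff_subset.trans (filter_subset _ _), fun i hi hsub => ?_, ?_⟩
  · have hmem := hsub (hf i hi)
    rw [mem_sdiff] at hmem
    refine hmem.2 (mem_image_of_mem f (mem_filter.2 ⟨hi, fun e he => ?_⟩))
    exact (mem_filter.1 (mem_sdiff.1 (hsub he)).1).2
  · have h1 : F₀.card ≤ (F₀ \ D).card + D.card := by
      have := Finset.le_card_sdiff D F₀
      omega
    have h2 : D.card ≤ (I.filter fun i => ∀ e ∈ J i, ω e = 0).card := card_image_le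
    have h3 : (F₀.card : ℝ) ≤ (F₀ \ D).card + (I.filter fun i => ∀ e ∈ J i, ω e = 0).card := by
      exact_mod_cast h1.trans (by omega)
    linarith

/-- Dense enough locally sparse `3`-graphs: a random `3`-graph of edge probability `100 / t` has
about `100 t² / 6` edges, but on average it has only `O(t)` pairs of a set of `k ≤ n` points and
`k - 1` edges inside it. The factor `14` is what `density_increment` needs. -/
theorem exists_locallySparse (n : ℕ) : ∃ t : ℕ, 0 < t ∧ ∃ F : Finset (Finset (Fin t)),
    F ⊆ powersetCard 3 univ ∧ LocallySparse n F ∧ 14 * t ^ 2 ≤ F.card := by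
  obtain ⟨K, hK⟩ : ∃ K : ℕ, K = n * (100 ^ n * 2 ^ n ^ 3) := ⟨_, rfl⟩
  obtain ⟨q, hq⟩ : ∃ q : ℕ, q = K + 50 := ⟨_, rfl⟩
  obtain ⟨t, ht⟩ : ∃ t : ℕ, t = 100 * (q + 1) := ⟨_, rfl⟩
  set I : Finset (Σ _ : ℕ, Σ _ : Finset (Fin t), Finset (Finset (Fin t))) :=
    (Icc 3 n).sigma fun k => (powersetCard k univ).sigma fun S =>
      powersetCard (k - 1) (powersetCard 3 S) with hI
  obtain ⟨F, hFT, hF, hcard⟩ := exists_subset_avoiding q (powersetCard 3 (univ : Finset (Fin t))) I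
    (fun i => i.2.2) (by
      rintro ⟨k, S, J⟩ hi
      simp only [hI, mem_sigma, mem_Icc, mem_powersetCard] at hi
      rw [← card_pos]; dsimp only; omega)
  refine ⟨t, by omega, F, hFT, ?_, ?_⟩
  · intro J hJF hJ hn
    by_contra hcon
    set S := J.biUnion id with hS
    have hJS : J ⊆ powersetCard 3 S := fun e he => mem_powersetCard.2
      ⟨subset_biUnion_of_mem id he, (mem_powersetCard.1 (hFT (hJF he))).2⟩
    have h3 : 3 ≤ S.card := by
      obtain ⟨e, he⟩ := hJ
      have := mem_powersetCard.1 (hJS he)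
      rw [← this.2]; exact card_le_card this.1
    obtain ⟨J', hJ', hJc⟩ := exists_subset_card_eq (show S.card - 1 ≤ J.card by omega)
    refine hF ⟨S.card, S, J'⟩ ?_ (hJ'.trans hJF)
    simp only [hI, mem_sigma, mem_Icc, mem_powersetCard]
    exact ⟨⟨h3, hn⟩, ⟨subset_univ _, trivial⟩, hJ'.trans hJS, hJc⟩
  · set Q : ℝ := ((q + 1 : ℕ) : ℝ) with hQ
    have hQpos : 0 < Q := by positivity
    have htQ : (t : ℝ) = 100 * Q := by rw [ht, hQ]; push_cast; ring
    have hsum : ∑ i ∈ I, Q⁻¹ ^ i.2.2.card ≤ K * t := by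
      rw [hI, Finset.sum_sigma]
      have hk : ∀ k ∈ Icc 3 n, (∑ s ∈ (powersetCard k (univ : Finset (Fin t))).sigma fun S =>
          powersetCard (k - 1) (powersetCard 3 S), Q⁻¹ ^ s.2.card)
            ≤ (100 ^ n * 2 ^ n ^ 3) * (t : ℝ) := by
        intro k hk
        rw [mem_Icc] at hk
        rw [Finset.sum_sigma]
        have hS : ∀ S ∈ powersetCard k (univ : Finset (Fin t)),
            ∑ J ∈ powersetCard (k - 1) (powersetCard 3 S), Q⁻¹ ^ J.card
              ≤ 2 ^ n ^ 3 * Q⁻¹ ^ (k - 1) := by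
          intro S hS
          rw [Finset.sum_congr rfl fun J hJ => by rw [(mem_powersetCard.1 hJ).2], sum_const,
            nsmul_eq_mul]
          gcongr
          have h1 : (powersetCard (k - 1) (powersetCard 3 S)).card
              ≤ 2 ^ (powersetCard 3 S).card := by
            rw [← card_powerset]; exact card_le_card (fun x hx =>
              mem_powerset.2 (mem_powersetCard.1 hx).1)
          have h2 : (powersetCard 3 S).card ≤ n ^ 3 := by
            rw [card_powersetCard, (mem_powersetCard.1 hS).2]
            exact (Nat.choose_le_pow k 3).trans (Nat.pow_le_pow_left hk.2 3)
          exact_mod_cast h1.trans (Nat.pow_le_pow_right (by norm_num) h2)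
        refine (Finset.sum_le_sum hS).trans ?_
        rw [sum_const, nsmul_eq_mul, card_powersetCard, card_univ, Fintype.card_fin]
        have h1 : ((t.choose k : ℕ) : ℝ) ≤ (t : ℝ) ^ (k - 1) * t := by
          rw [← pow_succ, Nat.sub_add_cancel (by omega)]
          exact_mod_cast Nat.choose_le_pow t k
        calc ((t.choose k : ℕ) : ℝ) * (2 ^ n ^ 3 * Q⁻¹ ^ (k - 1))
            ≤ ((t : ℝ) ^ (k - 1) * t) * (2 ^ n ^ 3 * Q⁻¹ ^ (k - 1)) := by gcongr
          _ = ((t : ℝ) * Q⁻¹) ^ (k - 1) * 2 ^ n ^ 3 * t := by rw [mul_pow]; ring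
          _ = 100 ^ (k - 1) * 2 ^ n ^ 3 * t := by
              rw [htQ, mul_assoc 100 Q, mul_inv_cancel₀ hQpos.ne', mul_one]
          _ ≤ (100 ^ n * 2 ^ n ^ 3) * (t : ℝ) := by
              gcongr
              · norm_num
              · omega
      refine (Finset.sum_le_sum hk).trans ?_
      rw [sum_const, nsmul_eq_mul, Nat.card_Icc, hK]
      push_cast
      rw [mul_assoc (n : ℝ)]
      gcongr
      omega
    have hT : ((powersetCard 3 (univ : Finset (Fin t))).card : ℝ) * Q⁻¹
        = 100 * ((t : ℝ) - 1) * (t - 2) / 6 := by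
      rw [card_powersetCard, card_univ, Fintype.card_fin, Nat.cast_choose_eq_descPochhammer_div]
      simp [descPochhammer_succ_right, Nat.factorial]
      rw [htQ]
      field_simp
    have htK : (K : ℝ) + 50 ≤ t := by
      rw [htQ, hQ]
      push_cast
      have : (q : ℝ) = K + 50 := by rw [hq]; push_cast; rfl
      have : (0 : ℝ) ≤ q := by positivity
      linarith
    have hK0 : (0 : ℝ) ≤ K := by positivity
    have : ((14 * t ^ 2 : ℕ) : ℝ) ≤ F.card := by
      push_cast
      nlinarith
    exact_mod_cast this

/-! ### Polynomial inequalities -/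

theorem amgm_three {x y z : ℝ} (hx : 0 ≤ x) (hy : 0 ≤ y) (hz : 0 ≤ z) :
    27 * (x * y * z) ≤ (x + y + z) ^ 3 := by
  nlinarith [mul_nonneg hx (sq_nonneg (y - z)), mul_nonneg hy (sq_nonneg (x - z)),
    mul_nonneg hz (sq_nonneg (x - y)), mul_nonneg hx (sq_nonneg (x - y)),
    mul_nonneg hx (sq_nonneg (x - z)), mul_nonneg hy (sq_nonneg (x - y)),
    mul_nonneg hy (sq_nonneg (y - z)), mul_nonneg hz (sq_nonneg (x - z)),
    mul_nonneg hz (sq_nonneg (y - z))]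

/-- The number `6 / 121 * (5 * √5 - 2)`. -/
noncomputable def alphaStar : ℝ := 6 / 121 * (5 * Real.sqrt 5 - 2)

theorem sqrt_five_bounds : 2.23606 < Real.sqrt 5 ∧ Real.sqrt 5 < 2.23607 := by
  constructor
  · rw [Real.lt_sqrt] <;> norm_num
  · rw [Real.sqrt_lt'] <;> norm_num

theorem alphaStar_bounds : 0.4552 < alphaStar ∧ alphaStar < 0.4553 := by
  obtain ⟨h1, h2⟩ := sqrt_five_bounds
  unfold alphaStar
  constructor <;> linarith

/-- As `y` varies, `3 y (T - y)² + (2/9) (T - 2 y)³` touches `alphaStar * T³` to second order at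
`y = (10 - 3 √5) / 11 * T`. -/
theorem alphaStar_sub_eq (T y : ℝ) :
    alphaStar * T ^ 3 - (3 * y * (T - y) ^ 2 + 2 / 9 * (T - 2 * y) ^ 3)
      = (y - (10 - 3 * Real.sqrt 5) / 11 * T) ^ 2
        * ((10 + 6 * Real.sqrt 5) / 9 * T - 11 / 9 * y) := by
  have h : Real.sqrt 5 ^ 2 = 5 := Real.sq_sqrt (by norm_num)
  have h3 : Real.sqrt 5 ^ 3 = 5 * Real.sqrt 5 := by rw [pow_succ, h]
  unfold alphaStar
  ring_nf
  rw [h3, h]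
  ring_nf

theorem cubic_le_alphaStar {T y : ℝ} (hy : 0 ≤ y) (hyT : y ≤ T) :
    3 * y * (T - y) ^ 2 + 2 / 9 * (T - 2 * y) ^ 3 ≤ alphaStar * T ^ 3 := by
  have h := alphaStar_sub_eq T y
  have h5 := sqrt_five_bounds.1
  have : 0 ≤ (10 + 6 * Real.sqrt 5) / 9 * T - 11 / 9 * y := by nlinarith
  have := mul_nonneg (sq_nonneg (y - (10 - 3 * Real.sqrt 5) / 11 * T)) this
  linarith

theorem three_mul_sq_le {s y : ℝ} (hs : 0 ≤ s) (hy : 0 ≤ y) :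
    3 * y * s ^ 2 ≤ alphaStar * (s + y) ^ 3 := by
  have h := amgm_three (by linarith : 0 ≤ s / 2) (by linarith : 0 ≤ s / 2) hy
  have h2 : 0 ≤ (s + y) ^ 3 := by positivity
  have := alphaStar_bounds.1
  nlinarith

/-- The first term on the left is at most `d ^ 3 / 27`, with equality at `a = d / 3`; as `a` grows
beyond `d / 3` it loses more than the second term gains. -/
theorem two_corrections_le {a d y : ℝ} (hd : d ≤ 3 * y) (hya : y ≤ a) (had : a ≤ d) :
    a * (d - a) ^ 2 / 4 + ((a - y) / 3) ^ 3 ≤ d ^ 3 / 27 := by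
  have hu : 0 ≤ a - d / 3 := by linarith
  have h1 : ((a - y) / 3) ^ 3 ≤ ((a - d / 3) / 3) ^ 3 := by
    apply pow_le_pow_left₀ <;> linarith
  have hd0 : 0 ≤ d - a := by linarith
  have : 0 ≤ (a - d / 3) ^ 2 * (27 * d - 31 * (a - d / 3)) := by
    apply mul_nonneg (sq_nonneg _); linarith
  nlinarith

theorem two_corrections_le_of_five_mul_le {T y : ℝ} (hy : 0 ≤ y) (hyT : 5 * y ≤ T) :
    3 * y * (T - y) ^ 2 + 2 / 9 * ((T - 2 * y) ^ 3 + (T - 3 * y) ^ 3) ≤ alphaStar * T ^ 3 := by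
  have hT : 0 ≤ T ^ 3 := by have : 0 ≤ T := by linarith
                            positivity
  have := alphaStar_bounds.1
  have h1 : 3 * y * (T - y) ^ 2 + 2 / 9 * ((T - 2 * y) ^ 3 + (T - 3 * y) ^ 3) ≤ 0.4552 * T ^ 3 := by
    nlinarith [mul_nonneg hy (sq_nonneg y), mul_nonneg hy (sq_nonneg T),
      mul_nonneg (mul_nonneg hy hy) (by linarith : 0 ≤ T - 5 * y),
      mul_nonneg (mul_nonneg hy (by linarith : 0 ≤ T - 5 * y)) (by linarith : 0 ≤ T - 5 * y),
      pow_nonneg (by linarith : 0 ≤ T - 5 * y) 3]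
  nlinarith

/-- With `s = a + b + c`, the left hand side is `3 y s²` plus the two corrections `6 a b (c - y)` and
`(2/9) max (0, a - y)³`. Each of them is at most `(2/9) (s - y)³` when it is positive; if both are
positive, their sum is bounded by `two_corrections_le` when `y` is at least a fifth of the total, and
otherwise `two_corrections_le_of_five_mul_le` applies. -/
theorem lagrangian_le {a b c y : ℝ} (ha : 0 ≤ a) (hb : 0 ≤ b) (hc : 0 ≤ c) (hy : 0 ≤ y) :
    3 * y * ((a + b + c) ^ 2 - 2 * (a * b)) + 6 * (a * b * c) + 2 / 9 * max 0 (a - y) ^ 3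
      ≤ alphaStar * (a + b + c + y) ^ 3 := by
  set s := a + b + c with hs
  have hs0 : 0 ≤ s := by positivity
  have hbase := three_mul_sq_le hs0 hy
  have hf : 3 * y * s ^ 2 + 2 / 9 * (s - y) ^ 3 ≤ alphaStar * (s + y) ^ 3 := by
    have := cubic_le_alphaStar (T := s + y) hy (by linarith)
    convert this using 3 <;> ring
  have hcube : ∀ {z : ℝ}, z ≤ s - y → max 0 z ^ 3 ≤ max 0 (s - y) ^ 3 := fun h =>
    pow_le_pow_left₀ (le_max_left _ _) (max_le_max le_rfl h) 3
  have hf' : 3 * y * s ^ 2 + 2 / 9 * max 0 (s - y) ^ 3 ≤ alphaStar * (s + y) ^ 3 := by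
    rcases max_cases 0 (s - y) with ⟨h, -⟩ | ⟨h, -⟩ <;> rw [h]
    · simpa using hbase
    · exact hf
  have hab := mul_nonneg ha hb
  by_cases hcy : c ≤ y
  · have h1 := hcube (z := a - y) (by linarith)
    nlinarith [mul_nonneg hab (by linarith : 0 ≤ y - c)]
  push Not at hcy
  have h27 := amgm_three ha hb (by linarith : 0 ≤ c - y)
  rcases le_total a y with hay | hay
  · rw [max_eq_left (by linarith)]
    have : a + b + (c - y) = s - y := by rw [hs]; ring
    rw [this] at h27
    nlinarith
  · rw [max_eq_right (by linarith)]
    rcases le_total (s - y) (3 * y) with h | h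
    · have h2 := two_corrections_le h hay (by linarith)
      have h3 : a * (b * (c - y)) ≤ a * ((s - y - a) ^ 2 / 4) := by
        gcongr
        rw [hs]
        nlinarith [sq_nonneg (b - (c - y))]
      nlinarith
    · have h2 := two_corrections_le_of_five_mul_le (T := s + y) hy (by linarith)
      have h3 : (a - y) ^ 3 ≤ (s - 2 * y) ^ 3 := pow_le_pow_left₀ (by linarith) (by linarith) 3
      have e1 : s + y - y = s := by ring
      have e2 : s + y - 2 * y = s - y := by ring
      have e3 : s + y - 3 * y = s - 2 * y := by ring
      rw [e1, e2, e3] at h2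
      have : a + b + (c - y) = s - y := by rw [hs]; ring
      rw [this] at h27
      nlinarith

/-! ### The weight of a locally sparse `3`-graph -/

/-- If `u` and `v` carry the two largest weights, then by Hall's theorem the edges have distinct
representatives outside `{u, v}`, and the other two vertices of an edge have a product of weights at
most `w u * w v`. -/
theorem LocallySparse.sum_prod_le {β : Type*} [Fintype β] [DecidableEq β] {n : ℕ}
    {F : Finset (Finset β)} (hF : LocallySparse n F) (h3 : ∀ e ∈ F, e.card = 3) {w : β → ℝ}
    (hw : ∀ x, 0 ≤ w x) (hn : (univ.filter fun x => w x ≠ 0).card ≤ n) {u v : β} (huv : u ≠ v)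
    (hu : ∀ x, w x ≤ w u) (hv : ∀ x, x ≠ u → w x ≤ w v) :
    ∑ e ∈ F, ∏ x ∈ e, w x ≤ w u * w v * (∑ x, w x - w u - w v) := by
  classical
  set F' := F.filter fun e => ∀ x ∈ e, w x ≠ 0 with hF'
  have hsum : ∑ e ∈ F, ∏ x ∈ e, w x = ∑ e ∈ F', ∏ x ∈ e, w x := by
    rw [hF', Finset.sum_filter]
    refine Finset.sum_congr rfl fun e _ => ?_
    split_ifs with h
    · rfl
    · push Not at h
      obtain ⟨x, hx, h0⟩ := h
      exact Finset.prod_eq_zero hx h0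
  obtain ⟨f, hf, hfe⟩ := (Finset.all_card_le_biUnion_card_iff_exists_injective
    (fun e : F' => e.1 \ {u, v})).1 (by
      intro s
      rcases s.eq_empty_or_nonempty with rfl | hs
      · simp
      set J := s.map (Function.Embedding.subtype _) with hJ
      have hJF : J ⊆ F' := by
        intro e he
        obtain ⟨e', -, rfl⟩ := mem_map.1 he
        exact e'.2
      have h1 : (J.biUnion id).card ≤ n := by
        refine (card_le_card fun x hx => ?_).trans hn
        obtain ⟨e, he, hxe⟩ := mem_biUnion.1 hx
        exact mem_filter.2 ⟨mem_univ _, (mem_filter.1 (hJF he)).2 x hxe⟩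
      have h2 := hF J (hJF.trans (filter_subset _ _)) (by simpa [hJ] using hs) h1
      have h3 : s.biUnion (fun e : F' => e.1 \ {u, v}) = J.biUnion id \ {u, v} := by
        ext x
        simp only [hJ, mem_biUnion, mem_sdiff, mem_map, id]
        constructor
        · rintro ⟨e, he, hx, hx'⟩
          exact ⟨⟨e.1, ⟨e, he, rfl⟩, hx⟩, hx'⟩
        · rintro ⟨⟨_, ⟨e, he, rfl⟩, hx⟩, hx'⟩
          exact ⟨e, he, hx, hx'⟩
      have h4 := Finset.le_card_sdiff ({u, v} : Finset β) (J.biUnion id)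
      have h5 : ({u, v} : Finset β).card ≤ 2 := card_le_two
      have h6 : J.card = s.card := card_map _
      rw [h3]
      omega)
  have hle : ∀ e : F', ∏ x ∈ e.1, w x ≤ w u * w v * w (f e) := by
    intro e
    have hfe' := hfe e
    rw [mem_sdiff] at hfe'
    have hc : (e.1.erase (f e)).card = 2 := by
      rw [card_erase_of_mem hfe'.1, h3 _ (mem_filter.1 e.2).1]
    obtain ⟨b, c, hbc, hbce⟩ := card_eq_two.1 hc
    rw [← Finset.mul_prod_erase _ _ hfe'.1, hbce, Finset.prod_pair hbc, mul_comm]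
    refine mul_le_mul_of_nonneg_right ?_ (hw _)
    by_cases hb : b = u
    · rw [hb]
      exact mul_le_mul_of_nonneg_left (hv c (by rintro rfl; exact hbc hb)) (hw u)
    · rw [mul_comm]
      exact mul_le_mul (hu c) (hv b hb) (hw b) (hw u)
  rw [hsum, ← Finset.sum_coe_sort]
  refine (Finset.sum_le_sum fun e _ => hle e).trans ?_
  rw [← Finset.mul_sum]
  refine mul_le_mul_of_nonneg_left ?_ (mul_nonneg (hw u) (hw v))
  have h1 : ∑ e : F', w (f e) = ∑ x ∈ univ.image f, w x := by
    rw [Finset.sum_image fun _ _ _ _ h => hf h]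
  have h2 : ∑ x ∈ univ.image f, w x ≤ ∑ x ∈ univ \ {u, v}, w x := by
    refine Finset.sum_le_sum_of_subset_of_nonneg (fun x hx => ?_) fun x _ _ => hw x
    obtain ⟨e, -, rfl⟩ := mem_image.1 hx
    exact mem_sdiff.2 ⟨mem_univ _, (mem_sdiff.1 (hfe e)).2⟩
  have h3 := Finset.sum_sdiff (f := w) (subset_univ ({u, v} : Finset β))
  rw [Finset.sum_pair huv] at h3
  linarith

/-- The weight of a locally sparse `3`-graph, compared with the weight lost because the pairs joined
to `y` must avoid the diagonal. -/
theorem LocallySparse.gain_sub_loss_le {β : Type*} [Fintype β] [DecidableEq β] {n : ℕ}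
    {F : Finset (Finset β)} (hF : LocallySparse n F) (h3 : ∀ e ∈ F, e.card = 3) {w : β → ℝ}
    (hw : ∀ x, 0 ≤ w x) (hn : (univ.filter fun x => w x ≠ 0).card ≤ n) {y : ℝ} (hy : 0 ≤ y) :
    6 * ∑ e ∈ F, ∏ x ∈ e, w x - 3 * y * ∑ x, w x ^ 2
      ≤ 2 / 9 * max 0 (∑ x, w x - y) ^ 3 := by
  have hm : 0 ≤ max 0 (∑ x, w x - y) ^ 3 := pow_nonneg (le_max_left _ _) 3
  have hsq : 0 ≤ ∑ x, w x ^ 2 := Finset.sum_nonneg fun x _ => sq_nonneg _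
  rcases F.eq_empty_or_nonempty with rfl | ⟨e, he⟩
  · rw [Finset.sum_empty]
    nlinarith [mul_nonneg hy hsq]
  obtain ⟨a, ha⟩ : e.Nonempty := by rw [← card_pos, h3 e he]; norm_num
  obtain ⟨u, -, hu⟩ := exists_max_image (univ : Finset β) w ⟨a, mem_univ a⟩
  obtain ⟨b, hb⟩ : (univ.erase u : Finset β).Nonempty := by
    rw [← card_pos, card_erase_of_mem (mem_univ u)]
    have := card_le_card (subset_univ e)
    rw [h3 e he] at this
    omega
  obtain ⟨v, hv, hvmax⟩ := exists_max_image (univ.erase u : Finset β) w ⟨b, hb⟩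
  have huv : u ≠ v := fun h => by simp [h] at hv
  have h1 := hF.sum_prod_le h3 hw hn huv (fun x => hu x (mem_univ x))
    (fun x hx => hvmax x (mem_erase.2 ⟨hx, mem_univ x⟩))
  have h2 : w u ^ 2 + w v ^ 2 ≤ ∑ x, w x ^ 2 := by
    rw [← Finset.sum_pair (f := fun x => w x ^ 2) huv]
    exact Finset.sum_le_sum_of_subset_of_nonneg (subset_univ _) fun x _ _ => sq_nonneg _
  have hp := hw u
  have hq := hw v
  have hpq := mul_nonneg hp hq
  have h3 : 6 * ∑ e ∈ F, ∏ x ∈ e, w x - 3 * y * ∑ x, w x ^ 2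
      ≤ 6 * (w u * w v * (∑ x, w x - w u - w v - y)) := by
    nlinarith [mul_nonneg hy (sq_nonneg (w u - w v)), mul_le_mul_of_nonneg_left h2 hy]
  rcases le_total 0 (∑ x, w x - w u - w v - y) with hz | hz
  · have h4 := amgm_three hp hq hz
    have e1 : w u + w v + (∑ x, w x - w u - w v - y) = ∑ x, w x - y := by ring
    rw [e1] at h4
    rw [max_eq_right (by linarith)]
    linarith
  · nlinarith [mul_nonneg hpq (neg_nonneg.2 hz)]

/-! ### Counting ordered triples -/

theorem triple_eq_iff {α : Type*} [DecidableEq α] {x y z a b c : α} (hab : a ≠ b) (hac : a ≠ c)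
    (hbc : b ≠ c) : ({x, y, z} : Finset α) = {a, b, c} ↔
      (x = a ∧ y = b ∧ z = c) ∨ (x = a ∧ y = c ∧ z = b) ∨ (x = b ∧ y = a ∧ z = c) ∨
      (x = b ∧ y = c ∧ z = a) ∨ (x = c ∧ y = a ∧ z = b) ∨ (x = c ∧ y = b ∧ z = a) := by
  constructor
  · intro h
    have hx : x ∈ ({a, b, c} : Finset α) := by rw [← h]; simp
    have hy : y ∈ ({a, b, c} : Finset α) := by rw [← h]; simp
    have hz : z ∈ ({a, b, c} : Finset α) := by rw [← h]; simp
    have ha : a ∈ ({x, y, z} : Finset α) := by rw [h]; simp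
    have hb : b ∈ ({x, y, z} : Finset α) := by rw [h]; simp
    have hc : c ∈ ({x, y, z} : Finset α) := by rw [h]; simp
    simp only [mem_insert, mem_singleton] at hx hy hz ha hb hc
    grind
  · rintro (⟨rfl, rfl, rfl⟩ | ⟨rfl, rfl, rfl⟩ | ⟨rfl, rfl, rfl⟩ | ⟨rfl, rfl, rfl⟩ |
      ⟨rfl, rfl, rfl⟩ | ⟨rfl, rfl, rfl⟩) <;> ext <;> simp <;> tauto

/-- Each `3`-set is listed by six ordered triples. -/
theorem sum_ordered_triples {α : Type*} [DecidableEq α] (W : Finset α) (E : Finset (Finset α))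
    (hE : E ⊆ powersetCard 3 W) (g : α → ℝ) :
    ∑ x ∈ W, ∑ y ∈ W, ∑ z ∈ W,
      (if ({x, y, z} : Finset α) ∈ E then g x * g y * g z else 0)
      = 6 * ∑ e ∈ E, ∏ x ∈ e, g x := by
  have h1 : ∀ x y z : α, (if ({x, y, z} : Finset α) ∈ E then g x * g y * g z else 0)
      = ∑ e ∈ E, if ({x, y, z} : Finset α) = e then g x * g y * g z else 0 := by
    intro x y z
    rw [Finset.sum_ite_eq]
  simp only [h1]
  have h2 : ∑ x ∈ W, ∑ y ∈ W, ∑ z ∈ W, ∑ e ∈ E,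
      (if ({x, y, z} : Finset α) = e then g x * g y * g z else 0)
      = ∑ e ∈ E, ∑ p ∈ W ×ˢ W ×ˢ W,
        (if ({p.1, p.2.1, p.2.2} : Finset α) = e then g p.1 * g p.2.1 * g p.2.2 else 0) := by
    symm
    simp only [Finset.sum_product]
    rw [Finset.sum_comm]
    refine Finset.sum_congr rfl fun x _ => ?_
    rw [Finset.sum_comm]
    refine Finset.sum_congr rfl fun y _ => ?_
    rw [Finset.sum_comm]
  rw [h2, Finset.mul_sum]
  refine Finset.sum_congr rfl fun e he => ?_
  obtain ⟨heW, he3⟩ := mem_powersetCard.1 (hE he)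
  obtain ⟨a, b, c, hab, hac, hbc, rfl⟩ := card_eq_three.1 he3
  have ha : a ∈ W := heW (by simp)
  have hb : b ∈ W := heW (by simp)
  have hc : c ∈ W := heW (by simp)
  rw [← Finset.sum_filter]
  have h3 : (W ×ˢ W ×ˢ W).filter (fun p => ({p.1, p.2.1, p.2.2} : Finset α) = {a, b, c})
      = {(a, b, c), (a, c, b), (b, a, c), (b, c, a), (c, a, b), (c, b, a)} := by
    ext ⟨x, y, z⟩
    simp only [mem_filter, mem_product, triple_eq_iff hab hac hbc, mem_insert, mem_singleton,
      Prod.mk.injEq]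
    constructor
    · exact fun h => h.2
    · intro h
      refine ⟨?_, h⟩
      rcases h with ⟨rfl, rfl, rfl⟩ | ⟨rfl, rfl, rfl⟩ | ⟨rfl, rfl, rfl⟩ | ⟨rfl, rfl, rfl⟩ |
        ⟨rfl, rfl, rfl⟩ | ⟨rfl, rfl, rfl⟩ <;> exact ⟨‹_›, ‹_›, ‹_›⟩
  have h4 : ∏ x ∈ ({a, b, c} : Finset α), g x = g a * (g b * g c) := by
    rw [Finset.prod_insert (by simp [hab, hac]), Finset.prod_pair hbc]
  rw [h3, h4]
  rw [Finset.sum_insert, Finset.sum_insert, Finset.sum_insert, Finset.sum_insert,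
    Finset.sum_pair]
  · ring
  all_goals simp [hab, hac, hbc, hab.symm, hac.symm, hbc.symm]

section Construction

variable {V β : Type} [Fintype β] [DecidableEq β]

/-! ### The construction and its number of edges -/

/-- Pairs which form an edge with each vertex of part `3`: all pairs outside part `3`, except those
between parts `0` and `1` and those with equal labels inside part `0`. -/
def PairRel (part : V → Fin 4) (lab : V → β) (x y : V) : Prop :=
  x ≠ y ∧ part x ≠ 3 ∧ part y ≠ 3 ∧ ¬(part x = 0 ∧ part y = 1) ∧ ¬(part x = 1 ∧ part y = 0) ∧
    ¬(part x = 0 ∧ part y = 0 ∧ lab x = lab y)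

/-- The edges of the construction, as a symmetric ternary relation: a vertex of part `3` with a
pair in `PairRel`, or one vertex from each of the parts `0`, `1`, `2`, or three vertices of part `0`
whose labels form a member of `F`. -/
def TripleRel (part : V → Fin 4) (lab : V → β) (F : Finset (Finset β)) (x y z : V) : Prop :=
  (part x = 3 ∧ PairRel part lab y z) ∨ (part y = 3 ∧ PairRel part lab x z) ∨
  (part z = 3 ∧ PairRel part lab x y) ∨ ({part x, part y, part z} : Finset (Fin 4)) = {0, 1, 2} ∨
  (part x = 0 ∧ part y = 0 ∧ part z = 0 ∧ ({lab x, lab y, lab z} : Finset β) ∈ F)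

/-- The number of vertices of `W` in part `i`. -/
noncomputable def partCount (part : V → Fin 4) (W : Finset V) (i : Fin 4) : ℝ :=
  ∑ x ∈ W, if part x = i then 1 else 0

/-- The number of vertices of `W` in part `0` with label `j`. -/
noncomputable def fibreCount (part : V → Fin 4) (lab : V → β) (W : Finset V) (j : β) : ℝ :=
  ∑ x ∈ W, if part x = 0 ∧ lab x = j then 1 else 0

theorem fin_four_cases (i : Fin 4) : i = 0 ∨ i = 1 ∨ i = 2 ∨ i = 3 := by
  revert i; decide

theorem sum_label (part : V → Fin 4) (lab : V → β) (W : Finset V) (h : β → ℝ) :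
    ∑ x ∈ W, (if part x = 0 then h (lab x) else 0) = ∑ j, fibreCount part lab W j * h j := by
  simp only [fibreCount, Finset.sum_mul]
  rw [Finset.sum_comm]
  refine Finset.sum_congr rfl fun x _ => ?_
  by_cases hx : part x = 0 <;> simp [hx]

theorem sum_fibreCount (part : V → Fin 4) (lab : V → β) (W : Finset V) :
    ∑ j, fibreCount part lab W j = partCount part W 0 := by
  have := sum_label part lab W fun _ => 1
  simp only [mul_one] at this
  rw [← this, partCount]

open Classical in
theorem sum_pairRel (part : V → Fin 4) (lab : V → β) (W : Finset V) :
    ∑ x ∈ W, ∑ y ∈ W, (if PairRel part lab x y then (1 : ℝ) else 0)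
      = (partCount part W 0 + partCount part W 1 + partCount part W 2) ^ 2
        - 2 * (partCount part W 0 * partCount part W 1) - ∑ j, fibreCount part lab W j ^ 2
        - partCount part W 1 - partCount part W 2 := by
  set p : Fin 4 → V → ℝ := fun i x => if part x = i then 1 else 0 with hp
  have hpt : ∀ x y : V, (if PairRel part lab x y then (1 : ℝ) else 0)
      = (p 0 x + p 1 x + p 2 x) * (p 0 y + p 1 y + p 2 y) - p 0 x * p 1 y - p 1 x * p 0 y
        - (if part x = 0 then (if part y = 0 then (if lab x = lab y then 1 else 0) else 0) else 0)
        - (if x = y then p 1 x + p 2 x else 0) := by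
    intro x y
    by_cases hxy : x = y
    · subst hxy
      rcases fin_four_cases (part x) with h | h | h | h <;> simp [hp, h, PairRel]
    · by_cases hl : lab x = lab y <;>
      rcases fin_four_cases (part x) with h | h | h | h <;>
      rcases fin_four_cases (part y) with h' | h' | h' | h' <;> simp [hp, h, h', PairRel, hxy, hl]
  have hdiag : ∑ x ∈ W, ∑ y ∈ W,
      (if part x = 0 then (if part y = 0 then (if lab x = lab y then (1 : ℝ) else 0) else 0) else 0)
      = ∑ j, fibreCount part lab W j ^ 2 := by
    have h1 : ∀ x ∈ W, ∑ y ∈ W, (if part x = 0 then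
        (if part y = 0 then (if lab x = lab y then (1 : ℝ) else 0) else 0) else 0)
        = if part x = 0 then fibreCount part lab W (lab x) else 0 := by
      intro x _
      split_ifs with hx
      · rw [sum_label part lab W fun j => if lab x = j then (1 : ℝ) else 0]
        simp
      · simp
    rw [Finset.sum_congr rfl h1, sum_label]
    simp only [sq]
  have hP : ∀ i, ∑ x ∈ W, p i x = partCount part W i := fun i => rfl
  simp only [hpt, Finset.sum_sub_distrib, ← Finset.sum_mul_sum, Finset.sum_add_distrib, hdiag, hP]
  have hd : ∑ x ∈ W, ∑ y ∈ W, (if x = y then p 1 x + p 2 x else 0)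
      = partCount part W 1 + partCount part W 2 := by
    rw [← hP, ← hP, ← Finset.sum_add_distrib]
    refine Finset.sum_congr rfl fun x hx => ?_
    rw [Finset.sum_ite_eq, if_pos hx]
  rw [hd]
  ring

open Classical in
theorem sum_tripleRel (part : V → Fin 4) (lab : V → β) {F : Finset (Finset β)}
    (hF : F ⊆ powersetCard 3 univ) (W : Finset V) :
    ∑ x ∈ W, ∑ y ∈ W, ∑ z ∈ W, (if TripleRel part lab F x y z then (1 : ℝ) else 0)
      = 3 * partCount part W 3 *
          ((partCount part W 0 + partCount part W 1 + partCount part W 2) ^ 2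
            - 2 * (partCount part W 0 * partCount part W 1) - ∑ j, fibreCount part lab W j ^ 2
            - partCount part W 1 - partCount part W 2)
        + 6 * (partCount part W 0 * partCount part W 1 * partCount part W 2)
        + 6 * ∑ e ∈ F, ∏ j ∈ e, fibreCount part lab W j := by
  set p : Fin 4 → V → ℝ := fun i x => if part x = i then 1 else 0 with hp
  set q : V → V → ℝ := fun x y => if PairRel part lab x y then 1 else 0 with hq
  set f : β → β → β → ℝ := fun i j l => if ({i, j, l} : Finset β) ∈ F then 1 else 0 with hf
  have hpt : ∀ x y z : V, (if TripleRel part lab F x y z then (1 : ℝ) else 0)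
      = p 3 x * q y z + p 3 y * q x z + q x y * p 3 z
        + (p 0 x * (p 1 y * p 2 z) + p 0 x * (p 2 y * p 1 z) + p 1 x * (p 0 y * p 2 z)
          + p 1 x * (p 2 y * p 0 z) + p 2 x * (p 0 y * p 1 z) + p 2 x * (p 1 y * p 0 z))
        + (if part x = 0 then (if part y = 0 then
            (if part z = 0 then f (lab x) (lab y) (lab z) else 0) else 0) else 0) := by
    intro x y z
    have h012 := @triple_eq_iff (Fin 4) _ (part x) (part y) (part z) 0 1 2 (by decide) (by decide)
      (by decide)
    simp only [TripleRel, h012]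
    rcases fin_four_cases (part x) with h | h | h | h <;>
    rcases fin_four_cases (part y) with h' | h' | h' | h' <;>
    rcases fin_four_cases (part z) with h'' | h'' | h'' | h'' <;>
    simp [hp, hq, hf, h, h', h'', PairRel]
  have hP : ∀ i, ∑ x ∈ W, p i x = partCount part W i := fun i => rfl
  have hQ := sum_pairRel part lab W
  have hFsum : ∑ x ∈ W, ∑ y ∈ W, ∑ z ∈ W, (if part x = 0 then (if part y = 0 then
      (if part z = 0 then f (lab x) (lab y) (lab z) else 0) else 0) else 0)
      = 6 * ∑ e ∈ F, ∏ j ∈ e, fibreCount part lab W j := by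
    rw [← sum_ordered_triples univ F hF]
    have h1 : ∀ x y : V, ∑ z ∈ W, (if part x = 0 then (if part y = 0 then
        (if part z = 0 then f (lab x) (lab y) (lab z) else 0) else 0) else 0)
        = if part x = 0 then (if part y = 0 then
          ∑ l, fibreCount part lab W l * f (lab x) (lab y) l else 0) else 0 := by
      intro x y
      rw [← sum_label part lab W fun l => f (lab x) (lab y) l]
      split_ifs <;> simp
    have h2 : ∀ x : V, ∑ y ∈ W, (if part x = 0 then (if part y = 0 then
          ∑ l, fibreCount part lab W l * f (lab x) (lab y) l else 0) else 0)
        = if part x = 0 then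
          ∑ j, fibreCount part lab W j * ∑ l, fibreCount part lab W l * f (lab x) j l else 0 := by
      intro x
      rw [← sum_label part lab W fun j => ∑ l, fibreCount part lab W l * f (lab x) j l]
      split_ifs <;> simp
    simp only [h1, h2]
    rw [sum_label part lab W fun i =>
      ∑ j, fibreCount part lab W j * ∑ l, fibreCount part lab W l * f i j l]
    simp only [Finset.mul_sum]
    refine Finset.sum_congr rfl fun i _ => Finset.sum_congr rfl fun j _ =>
      Finset.sum_congr rfl fun l _ => ?_
    simp only [hf]
    split_ifs <;> ring
  have hY1 : ∑ x ∈ W, ∑ y ∈ W, ∑ z ∈ W, p 3 x * q y z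
      = partCount part W 3 * ∑ y ∈ W, ∑ z ∈ W, q y z := by
    simp only [← Finset.mul_sum, ← Finset.sum_mul, hP]
  have hY2 : ∑ x ∈ W, ∑ y ∈ W, ∑ z ∈ W, p 3 y * q x z
      = partCount part W 3 * ∑ y ∈ W, ∑ z ∈ W, q y z := by
    rw [Finset.sum_comm]
    exact hY1
  have hY3 : ∑ x ∈ W, ∑ y ∈ W, ∑ z ∈ W, q x y * p 3 z
      = partCount part W 3 * ∑ y ∈ W, ∑ z ∈ W, q y z := by
    simp only [← Finset.mul_sum, ← Finset.sum_mul, hP]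
    rw [mul_comm]
  simp only [hpt, Finset.sum_add_distrib, hFsum, hY1, hY2, hY3]
  simp only [← Finset.mul_sum, ← Finset.sum_mul, hP]
  rw [hQ]
  ring

/-! ### The `3`-graph of the construction and its small subgraphs -/

theorem PairRel.symm {V β : Type} {part : V → Fin 4} {lab : V → β} {x y : V}
    (h : PairRel part lab x y) : PairRel part lab y x :=
  ⟨h.1.symm, h.2.2.1, h.2.1, fun h' => h.2.2.2.2.1 h'.symm, fun h' => h.2.2.2.1 h'.symm,
    fun h' => h.2.2.2.2.2 ⟨h'.2.1, h'.1, h'.2.2.symm⟩⟩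

theorem TripleRel.swap_left {V β : Type} [DecidableEq β] {part : V → Fin 4} {lab : V → β}
    {F : Finset (Finset β)} {x y z : V} (h : TripleRel part lab F x y z) :
    TripleRel part lab F y x z := by
  rcases h with h | h | ⟨h, h'⟩ | h | ⟨h1, h2, h3, h⟩
  · exact .inr (.inl h)
  · exact .inl h
  · exact .inr (.inr (.inl ⟨h, h'.symm⟩))
  · exact .inr (.inr (.inr (.inl (by rwa [Finset.insert_comm]))))
  · exact .inr (.inr (.inr (.inr ⟨h2, h1, h3, by rwa [Finset.insert_comm]⟩)))

theorem TripleRel.swap_right {V β : Type} [DecidableEq β] {part : V → Fin 4} {lab : V → β}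
    {F : Finset (Finset β)} {x y z : V} (h : TripleRel part lab F x y z) :
    TripleRel part lab F x z y := by
  rcases h with ⟨h, h'⟩ | h | h | h | ⟨h1, h2, h3, h⟩
  · exact .inl ⟨h, h'.symm⟩
  · exact .inr (.inr (.inl h))
  · exact .inr (.inl h)
  · exact .inr (.inr (.inr (.inl (by rwa [Finset.pair_comm]))))
  · exact .inr (.inr (.inr (.inr ⟨h1, h3, h2, by rwa [Finset.pair_comm]⟩)))

theorem TripleRel.ne {part : V → Fin 4} {lab : V → β} {F : Finset (Finset β)}
    (hF : F ⊆ powersetCard 3 univ) {x y z : V} (h : TripleRel part lab F x y z) : x ≠ y := by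
  rintro rfl
  rcases h with ⟨h, h'⟩ | ⟨h, h'⟩ | ⟨h, h'⟩ | h | ⟨-, -, -, h⟩
  · exact h'.2.1 h
  · exact h'.2.1 h
  · exact h'.1 rfl
  · rw [triple_eq_iff (by decide) (by decide) (by decide)] at h
    rcases fin_four_cases (part x) with h' | h' | h' | h' <;> simp [h'] at h
  · have h1 := (mem_powersetCard.1 (hF h)).2
    have h2 : ({lab x, lab x, lab z} : Finset β).card ≤ 2 := by
      rw [insert_eq_of_mem (mem_insert_self _ _)]
      exact card_le_two
    omega

open Classical in
/-- The `3`-graph on all of `V` whose edges are the sets `{x, y, z}` with `TripleRel x y z`. -/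
noncomputable def tripleGraph [Fintype V] (part : V → Fin 4) (lab : V → β)
    (F : Finset (Finset β)) : RGraph 3 V where
  verts := univ
  edges := (powersetCard 3 univ).filter fun e =>
    ∃ x y z, TripleRel part lab F x y z ∧ ({x, y, z} : Finset V) = e
  edges_subset := filter_subset _ _

open Classical in
theorem mem_tripleGraph_edges [Fintype V] {part : V → Fin 4} {lab : V → β}
    {F : Finset (Finset β)} (hF : F ⊆ powersetCard 3 univ) (x y z : V) :
    ({x, y, z} : Finset V) ∈ (tripleGraph part lab F).edges ↔ TripleRel part lab F x y z := by
  constructor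
  · intro h
    obtain ⟨a, b, c, h, he⟩ := (mem_filter.1 h).2
    rw [eq_comm, triple_eq_iff (h.ne hF) (h.swap_right.ne hF)
      (h.swap_left.swap_right.ne hF)] at he
    rcases he with ⟨rfl, rfl, rfl⟩ | ⟨rfl, rfl, rfl⟩ | ⟨rfl, rfl, rfl⟩ | ⟨rfl, rfl, rfl⟩ |
      ⟨rfl, rfl, rfl⟩ | ⟨rfl, rfl, rfl⟩
    · exact h
    · exact h.swap_right
    · exact h.swap_left
    · exact h.swap_left.swap_right
    · exact h.swap_right.swap_left
    · exact h.swap_left.swap_right.swap_left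
  · intro h
    refine mem_filter.2 ⟨mem_powersetCard.2 ⟨subset_univ _, ?_⟩, x, y, z, h, rfl⟩
    exact card_eq_three.2 ⟨x, y, z, h.ne hF, h.swap_right.ne hF, h.swap_left.swap_right.ne hF, rfl⟩

omit [Fintype β] [DecidableEq β] in
open Classical in
theorem RGraph.six_mul_card_edges (G : RGraph 3 V) :
    6 * (G.edges.card : ℝ) = ∑ x ∈ G.verts, ∑ y ∈ G.verts, ∑ z ∈ G.verts,
      if ({x, y, z} : Finset V) ∈ G.edges then (1 : ℝ) else 0 := by
  have := sum_ordered_triples G.verts G.edges G.edges_subset fun _ => 1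
  simp only [mul_one, prod_const_one, sum_const, nsmul_eq_mul] at this
  rw [this]

omit [Fintype β] [DecidableEq β] in
theorem RGraph.density_three (G : RGraph 3 V) :
    G.density = 6 * (G.edges.card : ℝ) /
      ((G.order : ℝ) * ((G.order : ℝ) - 1) * ((G.order : ℝ) - 2)) := by
  rw [RGraph.density, RGraph.order, card_powersetCard, Nat.cast_choose_eq_descPochhammer_div]
  simp only [descPochhammer_succ_right, descPochhammer_zero, Nat.factorial]
  simp
  rw [div_div_eq_mul_div, mul_comm]

theorem sum_partCount (part : V → Fin 4) (W : Finset V) :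
    partCount part W 0 + partCount part W 1 + partCount part W 2 + partCount part W 3
      = W.card := by
  simp only [partCount, ← Finset.sum_add_distrib]
  rw [Finset.card_eq_sum_ones, Nat.cast_sum]
  refine Finset.sum_congr rfl fun x _ => ?_
  rcases fin_four_cases (part x) with h | h | h | h <;> simp [h]

theorem partCount_nonneg (part : V → Fin 4) (W : Finset V) (i : Fin 4) :
    0 ≤ partCount part W i :=
  Finset.sum_nonneg fun _ _ => by split_ifs <;> norm_num

omit [Fintype β] in
theorem fibreCount_nonneg (part : V → Fin 4) (lab : V → β) (W : Finset V) (j : β) :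
    0 ≤ fibreCount part lab W j :=
  Finset.sum_nonneg fun _ _ => by split_ifs <;> norm_num

theorem card_support_fibreCount_le (part : V → Fin 4) (lab : V → β) (W : Finset V) :
    (univ.filter fun j => fibreCount part lab W j ≠ 0).card ≤ W.card := by
  refine (card_le_card fun j hj => ?_).trans (card_image_le (f := lab))
  obtain ⟨x, hx, h⟩ := Finset.exists_ne_zero_of_sum_ne_zero (mem_filter.1 hj).2
  by_cases hl : part x = 0 ∧ lab x = j
  · exact mem_image.2 ⟨x, hx, hl.2⟩
  · simp [hl] at h

/-- Subgraphs of bounded order have at most the edge count that `alphaStar` allows. -/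
theorem six_mul_card_edges_le [Fintype V] {part : V → Fin 4} {lab : V → β}
    {F : Finset (Finset β)} (hF : F ⊆ powersetCard 3 univ) {n : ℕ} (hs : LocallySparse n F)
    {H : RGraph 3 V} (hH : H.IsSubgraph (tripleGraph part lab F)) (hn : H.order = n) :
    6 * (H.edges.card : ℝ) ≤ alphaStar * (n : ℝ) ^ 3 := by
  classical
  have h1 : 6 * (H.edges.card : ℝ) ≤ ∑ x ∈ H.verts, ∑ y ∈ H.verts, ∑ z ∈ H.verts,
      if TripleRel part lab F x y z then (1 : ℝ) else 0 := by
    rw [H.six_mul_card_edges]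
    refine Finset.sum_le_sum fun x _ => Finset.sum_le_sum fun y _ => Finset.sum_le_sum fun z _ => ?_
    by_cases h : ({x, y, z} : Finset V) ∈ H.edges
    · have := (mem_tripleGraph_edges hF x y z).1 (by convert hH.2 h)
      rw [if_pos this]
      split_ifs
      all_goals norm_num
    · rw [if_neg (by convert h)]
      split_ifs <;> norm_num
  refine h1.trans ?_
  have h2 := sum_tripleRel part lab hF H.verts
  have h3 : H.verts.card = n := hn
  have h4 := hs.gain_sub_loss_le (fun e he => (mem_powersetCard.1 (hF he)).2)
    (fibreCount_nonneg part lab H.verts)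
    ((card_support_fibreCount_le part lab H.verts).trans h3.le) (partCount_nonneg part H.verts 3)
  rw [sum_fibreCount] at h4
  have p0 := partCount_nonneg part H.verts 0
  have p1 := partCount_nonneg part H.verts 1
  have p2 := partCount_nonneg part H.verts 2
  have p3 := partCount_nonneg part H.verts 3
  have h5 := lagrangian_le p0 p1 p2 p3
  rw [sum_partCount, h3] at h5
  rw [h2]
  -- the diagonal pairs in the parts `1` and `2` are given away here
  linarith [mul_nonneg p3 p1, mul_nonneg p3 p2]

end Construction

/-! ### Density of the construction -/

/-- The weights `1 : 1 : 1 + √5 : √5` are a critical point, so that rounding `√5 * k` to an integer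
costs only `O(k)` edges. -/
theorem rounding_error_le {k y : ℝ} (hk1 : 1 ≤ k) (hy0 : 0 ≤ y) (hy1 : y ≤ Real.sqrt 5 * k)
    (hy2 : Real.sqrt 5 * k ≤ y + 1) :
    (y - (10 - 3 * Real.sqrt 5) / 11 * (3 * k + 2 * y)) ^ 2
      * ((10 + 6 * Real.sqrt 5) / 9 * (3 * k + 2 * y) - 11 / 9 * y) ≤ 5 * k := by
  obtain ⟨h5, h5'⟩ := sqrt_five_bounds
  have h5sq : Real.sqrt 5 ^ 2 = 5 := Real.sq_sqrt (by norm_num)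
  have hy3 : y ≤ 2.24 * k := by nlinarith
  have e : y - (10 - 3 * Real.sqrt 5) / 11 * (3 * k + 2 * y)
      = (6 * Real.sqrt 5 - 9) / 11 * (y - Real.sqrt 5 * k) := by
    linear_combination (18 / 33 * k) * h5sq
  have e1 : ((6 * Real.sqrt 5 - 9) / 11) ^ 2 ≤ 0.17 := by nlinarith
  have e2 : (y - Real.sqrt 5 * k) ^ 2 ≤ 1 := by nlinarith
  have e3 : (10 + 6 * Real.sqrt 5) / 9 * (3 * k + 2 * y) - 11 / 9 * y ≤ 25 * k := by nlinarith
  have e4 : 0 ≤ (10 + 6 * Real.sqrt 5) / 9 * (3 * k + 2 * y) - 11 / 9 * y := by nlinarith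
  rw [e, mul_pow]
  calc _ ≤ 0.17 * 1 * (25 * k) := by gcongr
    _ ≤ 5 * k := by linarith

/-- The numerical core of the lower bound: rounding costs `O(t m)` edges and the diagonals cost
`O(t² m³)`; the locally sparse triples outweigh both. -/
theorem density_increment {t m y f : ℝ} (ht : 1 ≤ t) (hm : 1 ≤ m) (hy0 : 0 ≤ y)
    (hy1 : y ≤ Real.sqrt 5 * (t * m)) (hy2 : Real.sqrt 5 * (t * m) ≤ y + 1)
    (hf : 14 * t ^ 2 ≤ f) :
    (alphaStar + 1 / (243 * t)) * (3 * (t * m) + 2 * y) ^ 3 ≤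
      3 * y * ((t * m + t * m + (t * m + y)) ^ 2 - 2 * (t * m * (t * m)) - t * m ^ 2
        - t * m - (t * m + y))
      + 6 * (t * m * (t * m) * (t * m + y)) + 6 * (f * m ^ 3) := by
  obtain ⟨h5, h5'⟩ := sqrt_five_bounds
  obtain ⟨k, hk⟩ : ∃ k, k = t * m := ⟨_, rfl⟩
  have hk1 : 1 ≤ k := by rw [hk]; nlinarith
  rw [← hk] at hy1 hy2 ⊢
  have hy3 : y ≤ 2.24 * k := by nlinarith
  have hid := alphaStar_sub_eq (3 * k + 2 * y) y
  have herr := rounding_error_le hk1 hy0 hy1 hy2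
  have hT : 1 / (243 * t) * (3 * k + 2 * y) ^ 3 ≤ 3 * (t ^ 2 * m ^ 3) := by
    have h1 : (3 * k + 2 * y) ^ 3 ≤ (8 * k) ^ 3 := pow_le_pow_left₀ (by positivity) (by linarith) 3
    rw [one_div, inv_mul_le_iff₀ (by positivity)]
    have h2 : (8 * k) ^ 3 = 512 * (t ^ 3 * m ^ 3) := by rw [hk]; ring
    have h3 : 0 ≤ t ^ 3 * m ^ 3 := by positivity
    nlinarith
  have hf' : 84 * (t ^ 2 * m ^ 3) ≤ 6 * (f * m ^ 3) := by
    have : 14 * t ^ 2 * m ^ 3 ≤ f * m ^ 3 := by gcongr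
    linarith
  have hP : t * m ^ 2 * k = t ^ 2 * m ^ 3 := by rw [hk]; ring
  have hkk : k ≤ t ^ 2 * m ^ 3 := by
    rw [hk]
    have : 1 ≤ t * m ^ 2 := by nlinarith
    have : 0 ≤ t * m := by positivity
    nlinarith
  have hkk2 : k * k ≤ t ^ 2 * m ^ 3 := by
    have : 0 ≤ t ^ 2 * m ^ 2 := by positivity
    rw [hk]
    nlinarith
  have hloss : 3 * y * (t * m ^ 2 + k + (k + y)) ≤ 38 * (t ^ 2 * m ^ 3) := by
    have h1 : 3 * y * (t * m ^ 2 + k + (k + y)) ≤ 3 * (2.24 * k) * (t * m ^ 2 + k + (k + 2.24 * k)) := by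
      gcongr
    nlinarith
  rw [← hid] at herr
  have hid2 : 3 * y * ((k + k + (k + y)) ^ 2 - 2 * (k * k) - t * m ^ 2 - k - (k + y))
      + 6 * (k * k * (k + y)) + 6 * (f * m ^ 3)
      = 3 * y * (3 * k + 2 * y - y) ^ 2 + 2 / 9 * (3 * k + 2 * y - 2 * y) ^ 3
        - 3 * y * (t * m ^ 2 + k + (k + y)) + 6 * (f * m ^ 3) := by ring
  rw [hid2, add_mul]
  linarith

/-- A vertex type with prescribed part sizes, part `0` being split evenly among `t` labels. -/
theorem exists_parts {t : ℕ} (ht : 0 < t) (m b c y : ℕ) :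
    ∃ (V : Type) (_ : Fintype V) (part : V → Fin 4) (lab : V → Fin t),
      partCount part univ 0 = t * m ∧ partCount part univ 1 = b ∧ partCount part univ 2 = c ∧
      partCount part univ 3 = y ∧ ∀ j, fibreCount part lab univ j = m := by
  refine ⟨(Fin t × Fin m) ⊕ Fin b ⊕ Fin c ⊕ Fin y, inferInstance,
    Sum.elim (fun _ => 0) (Sum.elim (fun _ => 1) (Sum.elim (fun _ => 2) fun _ => 3)),
    Sum.elim Prod.fst fun _ => ⟨0, ht⟩, ?_, ?_, ?_, ?_, fun j => ?_⟩
  all_goals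
    simp only [partCount, fibreCount, Fintype.sum_sum_type, Fintype.sum_prod_type, Sum.elim_inl,
      Sum.elim_inr]
    simp

/-- The locally sparse triples give densities above `alphaStar` by a margin independent of `N`,
while subgraphs of order `n` stay within the edge count that `alphaStar` allows. -/
theorem exists_dense_locally_bounded (n : ℕ) : ∃ ε : ℝ, 0 < ε ∧ ∀ N : ℕ,
    ∃ (V : Type) (G : RGraph 3 V), N ≤ G.order ∧ alphaStar + ε ≤ G.density ∧
      ∀ H : RGraph 3 V, H.IsSubgraph G → H.order = n →
        6 * (H.edges.card : ℝ) ≤ alphaStar * (n : ℝ) ^ 3 := by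
  classical
  obtain ⟨t, ht, F, hF, hs, hcard⟩ := exists_locallySparse n
  have ht1 : (1 : ℝ) ≤ t := by exact_mod_cast ht
  refine ⟨1 / (243 * t), by positivity, fun N => ?_⟩
  obtain ⟨m, hm⟩ : ∃ m : ℕ, m = N + 1 := ⟨_, rfl⟩
  have hm1 : (1 : ℝ) ≤ m := by rw [hm]; push_cast; linarith [N.cast_nonneg (α := ℝ)]
  set y : ℕ := ⌊Real.sqrt 5 * (t * m : ℝ)⌋₊
  obtain ⟨V, _, part, lab, hc0, hc1, hc2, hc3, hfib⟩ := exists_parts ht m (t * m) (t * m + y) y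
  push_cast at hc1 hc2
  set G := tripleGraph part lab F
  have horder : (G.order : ℝ) = 3 * (t * m) + 2 * y := by
    have := sum_partCount part (univ : Finset V)
    rw [hc0, hc1, hc2, hc3] at this
    rw [RGraph.order, show G.verts = univ from rfl, ← this]
    ring
  have hedges : 6 * (G.edges.card : ℝ) =
      3 * y * ((t * m + t * m + (t * m + y)) ^ 2 - 2 * (t * m * (t * m)) - t * m ^ 2
        - t * m - (t * m + y))
      + 6 * (t * m * (t * m) * (t * m + y)) + 6 * (F.card * (m : ℝ) ^ 3) := by
    have h1 : 6 * (G.edges.card : ℝ) = ∑ x : V, ∑ y : V, ∑ z : V,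
        if TripleRel part lab F x y z then (1 : ℝ) else 0 := by
      rw [G.six_mul_card_edges]
      refine Finset.sum_congr rfl fun x _ => Finset.sum_congr rfl fun y _ =>
        Finset.sum_congr rfl fun z _ => ?_
      have := mem_tripleGraph_edges (part := part) (lab := lab) hF x y z
      exact if_congr (by convert this) rfl rfl
    have h2 : ∑ e ∈ F, ∏ j ∈ e, fibreCount part lab univ j = F.card * (m : ℝ) ^ 3 := by
      rw [Finset.sum_congr rfl fun e he => by
        rw [Finset.prod_congr rfl fun j _ => hfib j, prod_const, (mem_powersetCard.1 (hF he)).2]]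
      simp
    have h3 : ∑ j, fibreCount part lab univ j ^ 2 = t * (m : ℝ) ^ 2 := by
      simp [hfib]
    have h4 := sum_tripleRel part lab hF univ
    rw [h2, h3, hc0, hc1, hc2, hc3] at h4
    rw [h1, ← h4]
  have hk1 : (1 : ℝ) ≤ t * m := by nlinarith
  have hinc := density_increment ht1 hm1 (y.cast_nonneg) (Nat.floor_le (by positivity))
    (Nat.lt_floor_add_one _).le (f := F.card) (by exact_mod_cast hcard)
  rw [← hedges, ← horder] at hinc
  have hT3 : (3 : ℝ) ≤ G.order := by rw [horder]; linarith [y.cast_nonneg (α := ℝ)]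
  refine ⟨V, G, ?_, ?_, fun H hH hn => six_mul_card_edges_le hF hs hH hn⟩
  · have : (N : ℝ) ≤ G.order := by
      have h1 : (N : ℝ) ≤ m := by rw [hm]; push_cast; linarith
      rw [horder]
      nlinarith [y.cast_nonneg (α := ℝ)]
    exact_mod_cast this
  · have h0 : 0 < (G.order : ℝ) * (G.order - 1) * (G.order - 2) := by
      have h1 : 0 < (G.order : ℝ) - 1 := by linarith
      have h2 : 0 < (G.order : ℝ) - 2 := by linarith
      positivity
    rw [G.density_three, le_div_iff₀ h0]
    refine le_trans ?_ hinc
    have h1 : 0 ≤ alphaStar := by linarith [alphaStar_bounds.1]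
    gcongr
    nlinarith

theorem not_hasJump_alphaStar : ¬ HasJump 3 alphaStar := by
  rintro ⟨δ, hδ, hjump⟩
  obtain ⟨n, hn⟩ := exists_nat_gt (3 * (1 + δ) / δ)
  rw [div_lt_iff₀ hδ] at hn
  have hn3 : (3 : ℝ) < n := by
    by_contra h
    nlinarith
  obtain ⟨ε, hε, hG⟩ := exists_dense_locally_bounded n
  obtain ⟨N, hN⟩ := hjump ε hε n (by exact_mod_cast hn3.le)
  obtain ⟨V, G, hNG, hdens, hsub⟩ := hG N
  obtain ⟨H, hHG, hHn, hHd⟩ := hN V G hNG hdens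
  have h1 := hsub H hHG hHn
  have h0 : 0 < (n : ℝ) * (n - 1) * (n - 2) := by
    have h1 : 0 < (n : ℝ) - 1 := by linarith
    have h2 : 0 < (n : ℝ) - 2 := by linarith
    positivity
  rw [H.density_three, hHn, le_div_iff₀ h0] at hHd
  obtain ⟨ha, ha'⟩ := alphaStar_bounds
  -- as `n` exceeds `3 (1 + δ) / δ`, passing from `n ^ 3` to `n (n - 1) (n - 2)` costs less than `δ`
  have h2 : (n : ℝ) * (alphaStar * n ^ 2) < n * ((alphaStar + δ) * ((n - 1) * (n - 2))) := by
    apply mul_lt_mul_of_pos_left _ (by linarith)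
    nlinarith
  nlinarith

theorem mainTheorem2 :
    IsNonJump 3 (6 / 121 * (5 * Real.sqrt 5 - 2)) ∧
      (6 / 121 * (5 * Real.sqrt 5 - 2) : ℝ) ∈ Set.Ico (0.4552 : ℝ) 0.4553 := by
  obtain ⟨h1, h2⟩ := alphaStar_bounds
  have h3 := not_hasJump_alphaStar
  unfold alphaStar at h1 h2 h3
  exact ⟨⟨⟨by linarith, by linarith⟩, h3⟩, h1.le, h2⟩
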